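/- **Model.** Let $0\le s<1$ and $0<\gamma\le 1$; put $g=1/\gamma$ and $l=\max\{1-s,\gamma\}$. Finitely many nodes lie at points of the real line, any two at distance at least $\gamma$. Two nodes are linked (are neighbours) iff their distance is in $(s,1]$; the resulting graph is assumed connected, and $D$ is its (hop) diameter. Computation is synchronous. In each round each node either transmits or listens; a node $v$ receives a message iff it listens, no node within distance $s$ of $v$ transmits, and exactly one neighbour of $v$ transmits; it then receives that neighbour's message. Otherwise it perceives only background noise. Each node initially knows only $s$, $\gamma$ and its own coordinate; one node, the source, also holds a message $m$. All nodes are awake from the beginning. **Partition.** The line is cut at the multiples of $3$ into regions $[3k,3k+3)$. Each region is cut, from left to right, into $\mu=\lceil 3/l\rceil$ blocks of length $l$, and each block into $\nu=\lceil l/\gamma\rceil$ homes of length $\gamma$ (the last block of a region and the last home or homes of a block may be shorter or empty); all pieces contain their left and exclude their right end. Blocks in a region and homes in a block are numbered from left to right; the label of a node is its pair (block, home). **Algorithm $\mathcal B$** consists of Procedure $\mathcal D^*$ followed by Procedure $\mathcal T$. *Procedure $\mathcal D^*$* ($\mu\nu+(\mu\nu)^2$ rounds). First (Procedure $\mathcal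 D$), for each label $(b',h')$ in lexicographic order there is one round in which exactly the nodes labelled $(b',h')$ transmit "hello"; each node $u$ that hears a hello in that round puts $(b',h')$ into its set $N_u$, initially empty. Then, for each label $(b,h)$ and, inside that loop, for each label $(b',h')$, there is one round in which exactly the nodes labelled $(b,h)$ or $(b',h')$ transmit "hello"; each listening node $u$ that hears nothing in that round, and that heard a hello from $(b,h)$ during Procedure $\mathcal D$, adds $(b',h')$ to $N_u$. *Procedure $\mathcal T$.* In its first round the source transmits $m$. Then the following sweep of $6\mu$ rounds is repeated: for each block number $b=1,\dots,\mu$, six rounds are reserved for the blocks numbered $b$ in all regions; in these six rounds the left boundary, right boundary, left range, right range, left potential and right potential spokesmen of these blocks, in this order, transmit $m$, and all other nodes listen. Transmissions of $m$ carry the sender's coordinate. A node $u$ fixes its status at the beginning of the six rounds of its block from what it has received before. Let $O$ be the set of homes of its block that are its own or whose label lies in $N_u$, and let $R$ be the set of intervals $[p-1,p-s)$ and $(p+s,p+1]$, over the coordinates $p$ of all senders from which $u$ has received $m$. Say that $\sigma\in R$ ends right (left) if some point of the block lies to the right (left) of all of $\sigma$; a home is partially contained in $\sigma$ if it meets $\sigma$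 but is not contained in it. Then $u$ is - a right (left) boundary spokesman if its home is the rightmost (leftmost) in $O$ and is contained in some $\sigma\in R$; - a right (left) range spokesman if its home is not the rightmost (leftmost) in $O$, and it is the rightmost (leftmost) home in $O$ that is contained in some $\sigma\in R$ that ends right (left); - a right (left) potential spokesman if its home is the rightmost (leftmost) home of the block that is partially contained in some $\sigma\in R$ that ends right (left). **Theorem.** There are absolute constants $c,C>0$ such that for all $s,\gamma$, all such connected networks, every source and every message $m$: 1. the number of rounds of Procedure $\mathcal D^*$ is at least $c\,g^2$ and at most $C\,g^2$, and at its end $N_u$ is, for each node $u$, exactly the set of labels of the other nodes within distance $1$ of $u$; 2. Procedure $\mathcal T$ then informs all nodes of $m$ within $C\,D/l$ rounds; and Algorithm $\mathcal B$ informs all nodes within $C\,(D/l+g^2)$ rounds in total, i.e. it broadcasts in time $O(D/l+g^2)$. -/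

import Mathlib

namespace Highway

/-! ### The swamping radio model on the line -/

/-- Messages: a control message `hello`, or the source message together with the location of the
node that transmits it. -/
inductive Msg (M : Type*) where
  | hello : Msg M
  | data (m : M) (loc : ℝ) : Msg M

/-- What a node has perceived so far: entry `i` is what it received in round `i`
(`none` is background noise, which is also what collisions, swamping and one's own
transmissions leave). -/
abbrev History (M : Type*) := List (Option (Msg M))

/-- A deterministic distributed algorithm. From `s`, `γ`, its own location, the source message
(available at the source only) and its history, a node decides what to transmit in the next
round; `none` means that it listens. The number of the round is the length of the history. -/
abbrev Protocol (M : Type*) :=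
  (s γ x : ℝ) → (own : Option M) → (h : History M) → Option (Msg M)

/-- The network: nodes are linked iff their distance lies in `(s, 1]`. -/
def swampGraph {V : Type*} (s : ℝ) (pos : V → ℝ) : SimpleGraph V where
  Adj u v := u ≠ v ∧ s < |pos u - pos v| ∧ |pos u - pos v| ≤ 1
  symm := ⟨fun u v h => ⟨h.1.symm, by rw [abs_sub_comm]; exact h.2.1,
    by rw [abs_sub_comm]; exact h.2.2⟩⟩
  loopless := ⟨fun _ h => h.1 rfl⟩

open Classical in
/-- What `u` receives in a round in which each node `v` transmits `act v`: a message gets through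
iff `u` listens, no node within distance `s` of `u` transmits, and exactly one neighbour of `u`
transmits. -/
noncomputable def receive {V M : Type*} (s : ℝ) (pos : V → ℝ) (act : V → Option (Msg M)) (u : V) :
    Option (Msg M) :=
  if h : act u = none ∧ (∀ v, |pos u - pos v| ≤ s → act v = none) ∧
      ∃! v, (swampGraph s pos).Adj u v ∧ act v ≠ none
  then act h.2.2.choose else none

/-- The histories of all nodes after `t` rounds of the synchronous execution of `A`. -/
noncomputable def history {V M : Type*} (A : Protocol M) (s γ : ℝ) (pos : V → ℝ)
    (own : V → Option M) : ℕ → V → History M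
  | 0 => fun _ => []
  | t + 1 => fun u => history A s γ pos own t u ++
      [receive s pos (fun v => A s γ (pos v) (own v) (history A s γ pos own t v)) u]

open Classical in
/-- Only the source holds the message initially. -/
noncomputable def sourceInput {V M : Type*} (src : V) (m : M) (v : V) : Option M :=
  if v = src then some m else none

/-- After `t` rounds of `A`, started with message `m` at `src`, node `u` has the message `m`. -/
def Informed {V M : Type*} (A : Protocol M) (s γ : ℝ) (pos : V → ℝ) (src : V) (m : M)
    (t : ℕ) (u : V) : Prop :=
  u = src ∨ ∃ p, some (Msg.data m p) ∈ history A s γ pos (sourceInput src m) t u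

/-! ### The partition of the line into regions, blocks and homes (labels start at `0`) -/

/-- The length of a block. -/
noncomputable def blockLen (s γ : ℝ) : ℝ := max (1 - s) γ

/-- The number `μ` of blocks in a region. -/
noncomputable def numBlocks (s γ : ℝ) : ℕ := ⌈3 / blockLen s γ⌉₊

/-- The number `ν` of homes in a block. -/
noncomputable def numHomes (s γ : ℝ) : ℕ := ⌈blockLen s γ / γ⌉₊

/-- The number `μν` of (block, home) labels. -/
noncomputable def numLabels (s γ : ℝ) : ℕ := numBlocks s γ * numHomes s γ

/-- The left end of the region (of length `3`) that contains `x`. -/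
noncomputable def regionLeft (x : ℝ) : ℝ := 3 * (⌊x / 3⌋ : ℝ)

/-- The label, within its region, of the block that contains `x`. -/
noncomputable def blockIdx (s γ x : ℝ) : ℕ := ⌊(x - regionLeft x) / blockLen s γ⌋₊

/-- The left end of the block that contains `x`. -/
noncomputable def blockLeft (s γ x : ℝ) : ℝ := regionLeft x + blockIdx s γ x * blockLen s γ

/-- The right end of the block that contains `x` (the last block of a region may be shorter). -/
noncomputable def blockRight (s γ x : ℝ) : ℝ :=
  min (blockLeft s γ x + blockLen s γ) (regionLeft x + 3)

/-- The block that contains `x`. -/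
noncomputable def block (s γ x : ℝ) : Set ℝ := Set.Ico (blockLeft s γ x) (blockRight s γ x)

/-- The label, within its block, of the home that contains `x`. -/
noncomputable def homeIdx (s γ x : ℝ) : ℕ := ⌊(x - blockLeft s γ x) / γ⌋₊

/-- The home with label `k` in the block that contains `x` (the last one may be shorter). -/
noncomputable def home (s γ x : ℝ) (k : ℕ) : Set ℝ :=
  Set.Ico (blockLeft s γ x + k * γ) (min (blockLeft s γ x + (k + 1) * γ) (blockRight s γ x))

/-- The (block, home) label of the point `x`. -/
noncomputable def label (s γ x : ℝ) : ℕ × ℕ := (blockIdx s γ x, homeIdx s γ x)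

/-- The `i`-th label in the order of the double loop over blocks and homes. -/
noncomputable def loopLabel (s γ : ℝ) (i : ℕ) : ℕ × ℕ := (i / numHomes s γ, i % numHomes s γ)

/-! ### Procedure `D*`: neighbourhood discovery

Rounds `0, …, μν - 1` are Procedure `D`: round `i` belongs to the label `loopLabel i`.
Rounds `μν + j` with `j < (μν)²` are the Procedures `D_(b,h)`, one after the other, with
`(b,h) = loopLabel (j / μν)` and current label `loopLabel (j % μν)`. -/

/-- The number of rounds of Procedure `D*`. -/
noncomputable def dStarRounds (s γ : ℝ) : ℕ := numLabels s γ + numLabels s γ ^ 2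

/-- Whether a node at `x` transmits `hello` in round `t` of Procedure `D*`. -/
def dStarTransmits (s γ x : ℝ) (t : ℕ) : Prop :=
  (t < numLabels s γ ∧ label s γ x = loopLabel s γ t) ∨
  (numLabels s γ ≤ t ∧
    (label s γ x = loopLabel s γ ((t - numLabels s γ) / numLabels s γ) ∨
      label s γ x = loopLabel s γ ((t - numLabels s γ) % numLabels s γ)))

/-- The labels from which a `hello` was heard during Procedure `D`. -/
def heardLabels {M : Type*} (s γ : ℝ) (h : History M) : Set (ℕ × ℕ) :=
  {c | ∃ i < numLabels s γ, loopLabel s γ i = c ∧ h[i]? = some (some Msg.hello)}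

/-- The set `N_u` of labels known to a node at `x` with history `h`: those heard in Procedure `D`,
and each label whose turn in a Procedure `D_(b,h)` was silent, where the node listened and
had heard `(b,h)` in Procedure `D`. -/
def knownLabels {M : Type*} (s γ x : ℝ) (h : History M) : Set (ℕ × ℕ) :=
  heardLabels s γ h ∪
  {c | ∃ j < numLabels s γ ^ 2,
    loopLabel s γ (j % numLabels s γ) = c ∧
    loopLabel s γ (j / numLabels s γ) ∈ heardLabels s γ h ∧
    ¬ dStarTransmits s γ x (numLabels s γ + j) ∧
    h[numLabels s γ + j]? = some none}

/-! ### Spokesmen -/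

/-- The two intervals that form the communication range of a node at `p`. -/
def rangeParts (s p : ℝ) : Set (Set ℝ) :=
  {Set.Ico (p - 1) (p - s), Set.Ioc (p + s) (p + 1)}

/-- The parts of the ranges of all senders from which the source message was received in a round
before round `t`. -/
def heardRanges {M : Type*} (s : ℝ) (h : History M) (t : ℕ) : Set (Set ℝ) :=
  {σ | ∃ i < t, ∃ m p, h[i]? = some (some (Msg.data m p)) ∧ σ ∈ rangeParts s p}

/-- The homes of its own block that a node at `x` with history `h` knows to be occupied. -/
def occupied {M : Type*} (s γ x : ℝ) (h : History M) : Set ℕ :=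
  {k | k = homeIdx s γ x ∨ (blockIdx s γ x, k) ∈ knownLabels s γ x h}

/-- `σ` ends inside the block of `x` on the right: some point of the block is right of `σ`. -/
def EndsRight (s γ x : ℝ) (σ : Set ℝ) : Prop := ∃ y ∈ block s γ x, ∀ z ∈ σ, z < y

/-- `σ` ends inside the block of `x` on the left: some point of the block is left of `σ`. -/
def EndsLeft (s γ x : ℝ) (σ : Set ℝ) : Prop := ∃ y ∈ block s γ x, ∀ z ∈ σ, y < z

/-- The home `k` in the block of `x` is partially contained in `σ`. -/
def Partial (s γ x : ℝ) (k : ℕ) (σ : Set ℝ) : Prop :=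
  (home s γ x k ∩ σ).Nonempty ∧ ¬ home s γ x k ⊆ σ

/-- The six kinds of spokesmen, in the order in which they transmit. -/
inductive Kind where
  | leftBoundary | rightBoundary | leftRange | rightRange | leftPotential | rightPotential

/-- Whether a node at `x` with known occupied homes `O` in its block is a spokesman of a given
kind, where `R` are the parts of sender ranges known to it. -/
def IsSpokesman (s γ x : ℝ) (O : Set ℕ) (R : Set (Set ℝ)) : Kind → Prop
  | .leftBoundary =>
      (∃ σ ∈ R, home s γ x (homeIdx s γ x) ⊆ σ) ∧ ∀ k ∈ O, homeIdx s γ x ≤ k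
  | .rightBoundary =>
      (∃ σ ∈ R, home s γ x (homeIdx s γ x) ⊆ σ) ∧ ∀ k ∈ O, k ≤ homeIdx s γ x
  | .leftRange =>
      (∃ σ ∈ R, EndsLeft s γ x σ ∧ home s γ x (homeIdx s γ x) ⊆ σ) ∧
      (∀ k ∈ O, k < homeIdx s γ x → ∀ σ ∈ R, EndsLeft s γ x σ → ¬ home s γ x k ⊆ σ) ∧
      ∃ k ∈ O, k < homeIdx s γ x
  | .rightRange =>
      (∃ σ ∈ R, EndsRight s γ x σ ∧ home s γ x (homeIdx s γ x) ⊆ σ) ∧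
      (∀ k ∈ O, homeIdx s γ x < k → ∀ σ ∈ R, EndsRight s γ x σ → ¬ home s γ x k ⊆ σ) ∧
      ∃ k ∈ O, homeIdx s γ x < k
  | .leftPotential =>
      (∃ σ ∈ R, EndsLeft s γ x σ ∧ Partial s γ x (homeIdx s γ x) σ) ∧
      ∀ k < homeIdx s γ x, ∀ σ ∈ R, EndsLeft s γ x σ → ¬ Partial s γ x k σ
  | .rightPotential =>
      (∃ σ ∈ R, EndsRight s γ x σ ∧ Partial s γ x (homeIdx s γ x) σ) ∧
      ∀ k > homeIdx s γ x, ∀ σ ∈ R, EndsRight s γ x σ → ¬ Partial s γ x k σ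

/-! ### Procedure `T` and Algorithm `B` -/

/-- The kind of spokesman that transmits in round `i` of the six rounds of a block. -/
def kindOf : ℕ → Kind
  | 0 => .leftBoundary
  | 1 => .rightBoundary
  | 2 => .leftRange
  | 3 => .rightRange
  | 4 => .leftPotential
  | _ => .rightPotential

/-- The source message, as far as a node knows it. -/
def knownMessage {M : Type*} (own : Option M) (h : History M) : Option M :=
  own <|> h.findSome? fun r =>
    match r with
    | some (Msg.data m _) => some m
    | _ => none

/-- In round `1 + i` of Procedure `T` the nodes of the blocks with label `(i % 6μ) / 6` are in
turn, and among them the spokesmen of kind `kindOf (i % 6)`. The status of a node depends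
on the source messages it received before the six rounds of its block began. -/
def tTransmits {M : Type*} (s γ x : ℝ) (h : History M) (i : ℕ) : Prop :=
  blockIdx s γ x = (i % (6 * numBlocks s γ)) / 6 ∧
  IsSpokesman s γ x (occupied s γ x h)
    (heardRanges s h (dStarRounds s γ + 1 + (i - i % 6))) (kindOf (i % 6))

open Classical in
/-- Algorithm `B`: Procedure `D*`, followed by Procedure `T`, in which first the source transmits
the message once, and then the loop over all blocks is repeated. -/
noncomputable def algorithmB (M : Type*) : Protocol M := fun s γ x own h =>
  if h.length < dStarRounds s γ then
    (if dStarTransmits s γ x h.length then some Msg.hello else none)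
  else if h.length = dStarRounds s γ then
    own.map fun m => Msg.data m x
  else if tTransmits s γ x h (h.length - (dStarRounds s γ + 1)) then
    (knownMessage own h).map fun m => Msg.data m x
  else none

end Highway

/-! Discovery: regions have length 3 and blocks length at most 1, so equal labels never occur at two
nodes within distance 2 (`eq_of_label_eq`), and no listener has two transmitters of one label within
distance 1. Procedure `D` therefore reveals exactly the neighbours. A node `v` within distance `s`
of `u` is never heard, but it swamps `u`: when a neighbour `w` known to `u` transmits together with
the label of `v`, silence reveals `v` (`knownLabels_eq`).

Dissemination: if `γ ≤ 1 - s`, a block has the length `1 - s` of a range part, so a part ending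
inside the block cuts off an initial or final segment of homes; otherwise a block is a single home
and holds at most one node. All nodes inside a range part are neighbours of its sender, so they
learn of it together. Comparing two would-be spokesmen of one kind through the part that qualifies
one of them shows that their homes agree (`IsSpokesman.homeIdx_le`). By induction on rounds,
transmitters of Procedure `T` are never within distance 2 of each other (`uncrowded`), so every
transmission reaches all neighbours.

Progress: a node `u` that has received the message lies between two spokesmen `a ≤ u ≤ b` of its
block (`exists_spokesmen`) with `b - a < 1 - s`, and their ranges together cover that of `u`
(`in_range_of_between`). Each sweep thus gains one hop (`received_of_adj`), and a sweep has `6μ =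
O(1/l)` rounds. -/

namespace Highway

/-! ### Geometry of the partition -/

section Geometry

variable {s γ : ℝ}

lemma blockLen_pos (hγ : 0 < γ) : 0 < blockLen s γ := lt_max_of_lt_right hγ

lemma blockLen_le_one (hs : 0 ≤ s) (hγ1 : γ ≤ 1) : blockLen s γ ≤ 1 :=
  max_le (by linarith) hγ1

lemma regionLeft_le (x : ℝ) : regionLeft x ≤ x := by
  have := Int.floor_le (x / 3)
  unfold regionLeft
  linarith

lemma lt_regionLeft_add (x : ℝ) : x < regionLeft x + 3 := by
  have := Int.lt_floor_add_one (x / 3)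
  unfold regionLeft
  linarith

lemma blockLeft_le (hγ : 0 < γ) (x : ℝ) : blockLeft s γ x ≤ x := by
  have hl := blockLen_pos (s := s) hγ
  have h := Nat.floor_le (div_nonneg (sub_nonneg.2 (regionLeft_le x)) hl.le)
  rw [le_div_iff₀ hl] at h
  unfold blockLeft blockIdx
  linarith

lemma lt_blockLeft_add (hγ : 0 < γ) (x : ℝ) : x < blockLeft s γ x + blockLen s γ := by
  have hl := blockLen_pos (s := s) hγ
  have h := Nat.lt_floor_add_one ((x - regionLeft x) / blockLen s γ)
  rw [div_lt_iff₀ hl] at h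
  unfold blockLeft blockIdx
  linarith

lemma mem_block (hγ : 0 < γ) (x : ℝ) : x ∈ block s γ x :=
  ⟨blockLeft_le hγ x, lt_min (lt_blockLeft_add hγ x) (lt_regionLeft_add x)⟩

lemma mem_home (hγ : 0 < γ) (x : ℝ) : x ∈ home s γ x (homeIdx s γ x) := by
  have h0 := blockLeft_le (s := s) hγ x
  have h := Nat.floor_le (div_nonneg (sub_nonneg.2 h0) hγ.le)
  have h' := Nat.lt_floor_add_one ((x - blockLeft s γ x) / γ)
  rw [le_div_iff₀ hγ] at h
  rw [div_lt_iff₀ hγ] at h'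
  refine ⟨?_, lt_min ?_ (mem_block hγ x).2⟩
  · unfold homeIdx
    linarith
  · unfold homeIdx
    linarith

lemma home_subset_block (hγ : 0 < γ) (x : ℝ) (k : ℕ) : home s γ x k ⊆ block s γ x := by
  intro y hy
  refine ⟨le_trans ?_ hy.1, hy.2.trans_le (min_le_right _ _)⟩
  have : 0 ≤ (k : ℝ) * γ := by positivity
  linarith

lemma lt_of_mem_home_of_lt (hγ : 0 < γ) {x y z : ℝ} {j k : ℕ} (hjk : j < k)
    (hy : y ∈ home s γ x j) (hz : z ∈ home s γ x k) : y < z := by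
  have h1 := hy.2.trans_le (min_le_left _ _)
  have h2 := hz.1
  have h3 : ((j : ℝ) + 1) * γ ≤ k * γ := by
    gcongr
    exact_mod_cast hjk
  linarith

lemma blockIdx_lt (hγ : 0 < γ) (x : ℝ) : blockIdx s γ x < numBlocks s γ := by
  have hl := blockLen_pos (s := s) hγ
  rw [numBlocks, Nat.lt_ceil]
  refine (Nat.floor_le (div_nonneg (sub_nonneg.2 (regionLeft_le x)) hl.le)).trans_lt ?_
  have := lt_regionLeft_add x
  gcongr
  linarith

lemma homeIdx_lt (hγ : 0 < γ) (x : ℝ) : homeIdx s γ x < numHomes s γ := by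
  rw [numHomes, Nat.lt_ceil]
  refine (Nat.floor_le (div_nonneg (sub_nonneg.2 (blockLeft_le hγ x)) hγ.le)).trans_lt ?_
  have := lt_blockLeft_add (s := s) hγ x
  gcongr
  linarith

/-- The points `x` and `y` lie in the same block of the same region. -/
def SameBlock (s γ x y : ℝ) : Prop :=
  regionLeft x = regionLeft y ∧ blockIdx s γ x = blockIdx s γ y

namespace SameBlock

variable {x y z : ℝ}

lemma symm (h : SameBlock s γ x y) : SameBlock s γ y x := ⟨h.1.symm, h.2.symm⟩

lemma trans (h : SameBlock s γ x y) (h' : SameBlock s γ y z) : SameBlock s γ x z :=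
  ⟨h.1.trans h'.1, h.2.trans h'.2⟩

lemma blockLeft_eq (h : SameBlock s γ x y) : blockLeft s γ x = blockLeft s γ y := by
  simp only [blockLeft, h.1, h.2]

lemma block_eq (h : SameBlock s γ x y) : block s γ x = block s γ y := by
  simp only [block, blockRight, h.blockLeft_eq, h.1]

lemma home_eq (h : SameBlock s γ x y) : home s γ x = home s γ y := by
  funext k
  simp only [home, blockRight, h.blockLeft_eq, h.1]

lemma endsRight_iff (h : SameBlock s γ x y) (σ : Set ℝ) :
    EndsRight s γ x σ ↔ EndsRight s γ y σ := by
  simp only [EndsRight, h.block_eq]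

lemma endsLeft_iff (h : SameBlock s γ x y) (σ : Set ℝ) :
    EndsLeft s γ x σ ↔ EndsLeft s γ y σ := by
  simp only [EndsLeft, h.block_eq]

lemma partial_iff (h : SameBlock s γ x y) (k : ℕ) (σ : Set ℝ) :
    Partial s γ x k σ ↔ Partial s γ y k σ := by
  simp only [Partial, h.home_eq]

lemma abs_sub_lt (hγ : 0 < γ) (h : SameBlock s γ x y) : |x - y| < blockLen s γ := by
  have h1 := blockLeft_le (s := s) hγ x
  have h2 := blockLeft_le (s := s) hγ y
  have h3 := lt_blockLeft_add (s := s) hγ x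
  have h4 := lt_blockLeft_add (s := s) hγ y
  rw [h.blockLeft_eq] at h1 h3
  rw [abs_sub_lt_iff]
  constructor <;> linarith

lemma abs_sub_lt_of_homeIdx_eq (hγ : 0 < γ) (h : SameBlock s γ x y)
    (hk : homeIdx s γ x = homeIdx s γ y) : |x - y| < γ := by
  have hx := mem_home (s := s) hγ x
  have hy := mem_home (s := s) hγ y
  rw [h.home_eq, hk] at hx
  have h1 := hx.1
  have h2 := hy.1
  have h3 := hx.2.trans_le (min_le_left _ _)
  have h4 := hy.2.trans_le (min_le_left _ _)
  rw [abs_sub_lt_iff]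
  constructor <;> linarith

end SameBlock

/-- The offsets inside the regions cancel, so the region starts differ by less than 2 + 1 = 3, the
spacing of the regions. The bound 2 is what two nodes within distance 1 of a common listener
satisfy. -/
lemma sameBlock_of_abs_sub_le_two (hs : 0 ≤ s) (hγ : 0 < γ) (hγ1 : γ ≤ 1) {x y : ℝ}
    (h : blockIdx s γ x = blockIdx s γ y) (hxy : |x - y| ≤ 2) : SameBlock s γ x y := by
  refine ⟨?_, h⟩
  have hl := blockLen_le_one hs hγ1
  have h1 := blockLeft_le (s := s) hγ x
  have h2 := blockLeft_le (s := s) hγ y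
  have h3 := lt_blockLeft_add (s := s) hγ x
  have h4 := lt_blockLeft_add (s := s) hγ y
  obtain ⟨h5, h6⟩ := abs_sub_le_iff.1 hxy
  simp only [blockLeft, h, regionLeft] at *
  have ha : (⌊x / 3⌋ : ℝ) < ⌊y / 3⌋ + 1 := by linarith
  have hb : (⌊y / 3⌋ : ℝ) < ⌊x / 3⌋ + 1 := by linarith
  have ha' : ⌊x / 3⌋ < ⌊y / 3⌋ + 1 := by exact_mod_cast ha
  have hb' : ⌊y / 3⌋ < ⌊x / 3⌋ + 1 := by exact_mod_cast hb
  have : ⌊x / 3⌋ = ⌊y / 3⌋ := by omega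
  rw [this]

/-- The index of the round of Procedure `D` that belongs to the label of `x`. -/
noncomputable def labelIndex (s γ x : ℝ) : ℕ :=
  blockIdx s γ x * numHomes s γ + homeIdx s γ x

lemma labelIndex_lt (hγ : 0 < γ) (x : ℝ) : labelIndex s γ x < numLabels s γ := by
  have h1 := blockIdx_lt (s := s) hγ x
  have h2 := homeIdx_lt (s := s) hγ x
  have h3 : (blockIdx s γ x + 1) * numHomes s γ ≤ numBlocks s γ * numHomes s γ :=
    Nat.mul_le_mul_right _ h1
  unfold labelIndex numLabels
  linarith

lemma loopLabel_labelIndex (hγ : 0 < γ) (x : ℝ) :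
    loopLabel s γ (labelIndex s γ x) = label s γ x := by
  have h2 := homeIdx_lt (s := s) hγ x
  have h0 : 0 < numHomes s γ := by omega
  unfold loopLabel labelIndex label
  rw [Nat.mul_comm, Nat.mul_add_div h0, Nat.mul_add_mod, Nat.div_eq_of_lt h2,
    Nat.mod_eq_of_lt h2, add_zero]

/-- Within a block of length at most that of a range part, a range part that ends right is an
initial segment. -/
lemma home_subset_of_endsRight (hγ : 0 < γ) {x p : ℝ} {σ : Set ℝ}
    (hσ : σ ∈ rangeParts s p) (hE : EndsRight s γ x σ) {j k : ℕ} (hjk : j < k)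
    (hk : (home s γ x k ∩ σ).Nonempty) : home s γ x j ⊆ σ := by
  obtain ⟨y, hy, hyσ⟩ := hE
  obtain ⟨z, hz, hzσ⟩ := hk
  intro w hw
  have hwz := lt_of_mem_home_of_lt hγ hjk hw hz
  have hw0 := (home_subset_block hγ x j hw).1
  have hyr := hy.2.trans_le (min_le_left _ _)
  have hyz := hyσ z hzσ
  rcases le_total γ (1 - s) with h | h
  -- Block and range part both have length `1 - s`: as `y` lies beyond the right end of the part,
  -- the part begins left of the block.
  · rw [blockLen, max_eq_left h] at hyr
    rcases hσ with rfl | rfl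
    · have : p - s ≤ y := by
        by_contra hc
        exact lt_irrefl _ (hyσ y ⟨by linarith [hzσ.1], not_le.1 hc⟩)
      exact ⟨by linarith, by linarith [hzσ.2]⟩
    · have : p + 1 < y := by
        by_contra hc
        exact lt_irrefl _ (hyσ y ⟨by linarith [hzσ.1], not_lt.1 hc⟩)
      exact ⟨by linarith, by linarith [hzσ.2]⟩
  -- Here the block has length `γ`, so every home after number 0 is empty.
  · exfalso
    have h1 := (home_subset_block hγ x k hz).2.trans_le (min_le_left _ _)
    rw [blockLen, max_eq_right h] at h1
    have h2 := hz.1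
    have h3 : (1 : ℝ) * γ ≤ k * γ := by
      gcongr
      exact_mod_cast (by omega : 1 ≤ k)
    linarith

/-- Within a block of length at most that of a range part, a range part that ends left is a
final segment. -/
lemma home_subset_of_endsLeft (hγ : 0 < γ) {x p : ℝ} {σ : Set ℝ}
    (hσ : σ ∈ rangeParts s p) (hE : EndsLeft s γ x σ) {j k : ℕ} (hjk : j < k)
    (hj : (home s γ x j ∩ σ).Nonempty) : home s γ x k ⊆ σ := by
  obtain ⟨y, hy, hyσ⟩ := hE
  obtain ⟨z, hz, hzσ⟩ := hj
  intro w hw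
  have hwz := lt_of_mem_home_of_lt hγ hjk hz hw
  have hw1 := (home_subset_block hγ x k hw).2.trans_le (min_le_left _ _)
  have hyl := hy.1
  have hyz := hyσ z hzσ
  rcases le_total γ (1 - s) with h | h
  · rw [blockLen, max_eq_left h] at hw1
    rcases hσ with rfl | rfl
    · have : y < p - 1 := by
        by_contra hc
        exact lt_irrefl _ (hyσ y ⟨not_lt.1 hc, by linarith [hzσ.2]⟩)
      exact ⟨by linarith [hzσ.1], by linarith⟩
    · have : y ≤ p + s := by
        by_contra hc
        exact lt_irrefl _ (hyσ y ⟨not_le.1 hc, by linarith [hzσ.2]⟩)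
      exact ⟨by linarith [hzσ.1], by linarith⟩
  · exfalso
    rw [blockLen, max_eq_right h] at hw1
    have h2 := hw.1
    have h3 : (1 : ℝ) * γ ≤ k * γ := by
      gcongr
      exact_mod_cast (by omega : 1 ≤ k)
    linarith

lemma ordConnected_of_mem_rangeParts {p : ℝ} {σ : Set ℝ} (hσ : σ ∈ rangeParts s p) :
    σ.OrdConnected := by
  rcases hσ with rfl | rfl
  · exact Set.ordConnected_Ico
  · exact Set.ordConnected_Ioc

/-- A range part is order-connected, so all of it lies on one side of a missed point. -/
lemma endsRight_or_endsLeft {x p y z : ℝ} {σ : Set ℝ} (hσ : σ ∈ rangeParts s p)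
    (hy : y ∈ block s γ x) (hyσ : y ∉ σ) (hz : z ∈ σ) :
    EndsRight s γ x σ ∨ EndsLeft s γ x σ := by
  have hc := ordConnected_of_mem_rangeParts hσ
  rcases lt_or_gt_of_ne (fun h => hyσ (h ▸ hz) : y ≠ z) with h | h
  · right
    refine ⟨y, hy, fun w hw => ?_⟩
    by_contra hwy
    exact hyσ (hc.out hw hz ⟨not_lt.1 hwy, h.le⟩)
  · left
    refine ⟨y, hy, fun w hw => ?_⟩
    by_contra hwy
    exact hyσ (hc.out hz hw ⟨h.le, not_lt.1 hwy⟩)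

/-- A point in the range of `u` is also in the range of one of two points on both sides of `u` that
are close to each other. -/
lemma in_range_of_between (hs : 0 ≤ s) {a b u w : ℝ} (hau : a ≤ u) (hub : u ≤ b)
    (hab : b < a + (1 - s)) (h1 : s < |w - u|) (h2 : |w - u| ≤ 1) :
    (s < |w - a| ∧ |w - a| ≤ 1) ∨ (s < |w - b| ∧ |w - b| ≤ 1) := by
  obtain ⟨h3, h4⟩ := abs_le.1 h2
  rcases lt_abs.1 h1 with h | h
  -- If `b` is too close to `w`, then `w - a ≤ s + (b - a) < 1`, so `a` takes over.
  · rcases lt_or_ge s (w - b) with h' | h'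
    · exact Or.inr ⟨lt_abs.2 (Or.inl h'), abs_le.2 ⟨by linarith, by linarith⟩⟩
    · exact Or.inl ⟨lt_abs.2 (Or.inl (by linarith)), abs_le.2 ⟨by linarith, by linarith⟩⟩
  · rcases lt_or_ge s (a - w) with h' | h'
    · exact Or.inl ⟨lt_abs.2 (Or.inr (by linarith)), abs_le.2 ⟨by linarith, by linarith⟩⟩
    · exact Or.inr ⟨lt_abs.2 (Or.inr (by linarith)), abs_le.2 ⟨by linarith, by linarith⟩⟩

end Geometry

/-! ### Uniqueness and existence of spokesmen -/

section Spokesmen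

variable {s γ : ℝ}

/-- Suppose `x` has the smaller home number. On the left kinds the part qualifying `x` ends left,
hence covers the home of `y`; so `y` knows it too and is beaten by `x`. The right kinds are the
mirror image, and the boundary kinds need only `O`. `R` and `R'` may differ, but agree on the parts
that matter. -/
lemma IsSpokesman.homeIdx_le (hγ : 0 < γ) {x y : ℝ} (hxy : SameBlock s γ x y) {O : Set ℕ}
    (hx : homeIdx s γ x ∈ O) (hy : homeIdx s γ y ∈ O) {R R' : Set (Set ℝ)}
    (hR : ∀ σ ∈ R, ∃ p, σ ∈ rangeParts s p) (hR' : ∀ σ ∈ R', ∃ p, σ ∈ rangeParts s p)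
    (hRR' : ∀ σ ∈ R, y ∈ σ → σ ∈ R') (hR'R : ∀ σ ∈ R', x ∈ σ → σ ∈ R) {κ : Kind}
    (hκ : IsSpokesman s γ x O R κ) (hκ' : IsSpokesman s γ y O R' κ) :
    homeIdx s γ y ≤ homeIdx s γ x := by
  by_contra! hlt
  have hxm := mem_home (s := s) hγ x
  have hym := mem_home (s := s) hγ y
  rw [hxy.home_eq] at hxm
  cases κ with
  | leftBoundary => exact absurd (hκ'.2 _ hx) (not_le.2 hlt)
  | rightBoundary => exact absurd (hκ.2 _ hy) (not_le.2 hlt)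
  | leftRange =>
    obtain ⟨σ, hσ, hE, hsub⟩ := hκ.1
    obtain ⟨p, hp⟩ := hR σ hσ
    rw [hxy.endsLeft_iff] at hE
    rw [hxy.home_eq] at hsub
    have h := home_subset_of_endsLeft hγ hp hE hlt ⟨_, hxm, hsub hxm⟩
    exact hκ'.2.1 _ hx hlt σ (hRR' σ hσ (h hym)) hE hsub
  | rightRange =>
    obtain ⟨σ, hσ, hE, hsub⟩ := hκ'.1
    obtain ⟨p, hp⟩ := hR' σ hσ
    have h := home_subset_of_endsRight hγ hp hE hlt ⟨_, hym, hsub hym⟩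
    refine hκ.2.1 _ hy hlt σ (hR'R σ hσ (h hxm)) ((hxy.endsRight_iff σ).2 hE) ?_
    rwa [hxy.home_eq]
  | leftPotential =>
    obtain ⟨σ, hσ, hE, hsub⟩ := hκ.1
    obtain ⟨p, hp⟩ := hR σ hσ
    rw [hxy.endsLeft_iff] at hE
    rw [hxy.partial_iff] at hsub
    have h := home_subset_of_endsLeft hγ hp hE hlt hsub.1
    exact hκ'.2 _ hlt σ (hRR' σ hσ (h hym)) hE hsub
  | rightPotential =>
    obtain ⟨σ, hσ, hE, hsub⟩ := hκ'.1
    obtain ⟨p, hp⟩ := hR' σ hσ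
    have h := home_subset_of_endsRight hγ hp hE hlt hsub.1
    exact hκ.2 _ hlt σ (hR'R σ hσ (h hxm)) ((hxy.endsRight_iff σ).2 hE)
      ((hxy.partial_iff _ _).2 hsub)

variable {V : Type*} {pos : V → ℝ}

/-- The homes in the block of `x` in which some node lives. -/
def occupiedHomes (s γ : ℝ) (pos : V → ℝ) (x : ℝ) : Set ℕ :=
  {k | ∃ v, SameBlock s γ (pos v) x ∧ homeIdx s γ (pos v) = k}

lemma SameBlock.occupiedHomes_eq {x y : ℝ} (h : SameBlock s γ x y) :
    occupiedHomes s γ pos x = occupiedHomes s γ pos y := by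
  ext k
  exact exists_congr fun v => and_congr_left fun _ =>
    ⟨fun h' => h'.trans h, fun h' => h'.trans h.symm⟩

lemma eq_of_homeIdx_eq (hγ : 0 < γ) (hsep : ∀ u v : V, u ≠ v → γ ≤ |pos u - pos v|) {u v : V}
    (h : SameBlock s γ (pos u) (pos v)) (hk : homeIdx s γ (pos u) = homeIdx s γ (pos v)) :
    u = v := by
  by_contra hne
  exact absurd (hsep u v hne) (not_le.2 (h.abs_sub_lt_of_homeIdx_eq hγ hk))

lemma pos_le_of_homeIdx_le (hγ : 0 < γ) (hsep : ∀ u v : V, u ≠ v → γ ≤ |pos u - pos v|) {u v : V}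
    (h : SameBlock s γ (pos u) (pos v)) (hk : homeIdx s γ (pos u) ≤ homeIdx s γ (pos v)) :
    pos u ≤ pos v := by
  rcases hk.lt_or_eq with hk | hk
  · have hu := mem_home (s := s) hγ (pos u)
    rw [h.home_eq] at hu
    exact (lt_of_mem_home_of_lt hγ hk hu (mem_home hγ _)).le
  · rw [eq_of_homeIdx_eq hγ hsep h hk]

/-! ### Existence of spokesmen around a reached node. -/

variable [Finite V] {R : V → Set (Set ℝ)}

/-- The leftmost node of the block qualifies: its home lies in `σ`, so by `hR` it knows `σ` itself.
-/
lemma exists_leftBoundary (hγ : 0 < γ) (hR : ∀ u v, ∀ σ ∈ R u, pos v ∈ σ → σ ∈ R v)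
    {u : V} {σ : Set ℝ} (hσ : σ ∈ R u)
    (hsub : ∀ k ≤ homeIdx s γ (pos u), home s γ (pos u) k ⊆ σ) :
    ∃ v, SameBlock s γ (pos v) (pos u) ∧ homeIdx s γ (pos v) ≤ homeIdx s γ (pos u) ∧
      IsSpokesman s γ (pos v) (occupiedHomes s γ pos (pos v)) (R v) .leftBoundary := by
  obtain ⟨v, hv, hmin⟩ := Set.exists_min_image {v | SameBlock s γ (pos v) (pos u)}
    (fun v => homeIdx s γ (pos v)) (Set.toFinite _) ⟨u, rfl, rfl⟩
  have hle := hmin u ⟨rfl, rfl⟩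
  have hsub' : home s γ (pos v) (homeIdx s γ (pos v)) ⊆ σ := by
    rw [SameBlock.home_eq hv]
    exact hsub _ hle
  refine ⟨v, hv, hle, ⟨σ, hR u v σ hσ (hsub' (mem_home hγ _)), hsub'⟩, ?_⟩
  rintro k ⟨w, hw, rfl⟩
  exact hmin w (hw.trans hv)

lemma exists_rightBoundary (hγ : 0 < γ) (hR : ∀ u v, ∀ σ ∈ R u, pos v ∈ σ → σ ∈ R v)
    {u : V} {σ : Set ℝ} (hσ : σ ∈ R u)
    (hsub : ∀ k ≥ homeIdx s γ (pos u), home s γ (pos u) k ⊆ σ) :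
    ∃ v, SameBlock s γ (pos v) (pos u) ∧ homeIdx s γ (pos u) ≤ homeIdx s γ (pos v) ∧
      IsSpokesman s γ (pos v) (occupiedHomes s γ pos (pos v)) (R v) .rightBoundary := by
  obtain ⟨v, hv, hmax⟩ := Set.exists_max_image {v | SameBlock s γ (pos v) (pos u)}
    (fun v => homeIdx s γ (pos v)) (Set.toFinite _) ⟨u, rfl, rfl⟩
  have hle := hmax u ⟨rfl, rfl⟩
  have hsub' : home s γ (pos v) (homeIdx s γ (pos v)) ⊆ σ := by
    rw [SameBlock.home_eq hv]
    exact hsub _ hle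
  refine ⟨v, hv, hle, ⟨σ, hR u v σ hσ (hsub' (mem_home hγ _)), hsub'⟩, ?_⟩
  rintro k ⟨w, hw, rfl⟩
  exact hmax w (hw.trans hv)

/-- Take the rightmost node whose home lies in a right-ending part it knows. Whether the block has
an occupied home further right decides between the two kinds. -/
lemma exists_rightBoundary_or_rightRange (hγ : 0 < γ)
    (hR : ∀ u v, ∀ σ ∈ R u, pos v ∈ σ → σ ∈ R v) {u : V} {σ : Set ℝ} (hσ : σ ∈ R u)
    (hE : EndsRight s γ (pos u) σ) (hsub : home s γ (pos u) (homeIdx s γ (pos u)) ⊆ σ) :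
    ∃ v, SameBlock s γ (pos v) (pos u) ∧ homeIdx s γ (pos u) ≤ homeIdx s γ (pos v) ∧
      ∃ κ, IsSpokesman s γ (pos v) (occupiedHomes s γ pos (pos v)) (R v) κ := by
  obtain ⟨v, ⟨hv, τ, hτ, hEτ, hsubτ⟩, hmax⟩ := Set.exists_max_image
    {v | SameBlock s γ (pos v) (pos u) ∧ ∃ τ ∈ R v, EndsRight s γ (pos v) τ ∧
      home s γ (pos v) (homeIdx s γ (pos v)) ⊆ τ}
    (fun v => homeIdx s γ (pos v)) (Set.toFinite _) ⟨u, ⟨rfl, rfl⟩, σ, hσ, hE, hsub⟩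
  refine ⟨v, hv, hmax u ⟨⟨rfl, rfl⟩, σ, hσ, hE, hsub⟩, ?_⟩
  by_cases hlast : ∃ k ∈ occupiedHomes s γ pos (pos v), homeIdx s γ (pos v) < k
  · refine ⟨.rightRange, ⟨τ, hτ, hEτ, hsubτ⟩, ?_, hlast⟩
    rintro k ⟨w, hw, rfl⟩ hlt ρ hρ hEρ hsubρ
    rw [← hw.home_eq] at hsubρ
    exact absurd (hmax w ⟨hw.trans hv, ρ, hR v w ρ hρ (hsubρ (mem_home hγ _)),
      (hw.endsRight_iff ρ).2 hEρ, hsubρ⟩) (not_le.2 hlt)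
  · push Not at hlast
    exact ⟨.rightBoundary, ⟨τ, hτ, hsubτ⟩, hlast⟩

lemma exists_leftBoundary_or_leftRange (hγ : 0 < γ)
    (hR : ∀ u v, ∀ σ ∈ R u, pos v ∈ σ → σ ∈ R v) {u : V} {σ : Set ℝ} (hσ : σ ∈ R u)
    (hE : EndsLeft s γ (pos u) σ) (hsub : home s γ (pos u) (homeIdx s γ (pos u)) ⊆ σ) :
    ∃ v, SameBlock s γ (pos v) (pos u) ∧ homeIdx s γ (pos v) ≤ homeIdx s γ (pos u) ∧
      ∃ κ, IsSpokesman s γ (pos v) (occupiedHomes s γ pos (pos v)) (R v) κ := by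
  obtain ⟨v, ⟨hv, τ, hτ, hEτ, hsubτ⟩, hmin⟩ := Set.exists_min_image
    {v | SameBlock s γ (pos v) (pos u) ∧ ∃ τ ∈ R v, EndsLeft s γ (pos v) τ ∧
      home s γ (pos v) (homeIdx s γ (pos v)) ⊆ τ}
    (fun v => homeIdx s γ (pos v)) (Set.toFinite _) ⟨u, ⟨rfl, rfl⟩, σ, hσ, hE, hsub⟩
  refine ⟨v, hv, hmin u ⟨⟨rfl, rfl⟩, σ, hσ, hE, hsub⟩, ?_⟩
  by_cases hfirst : ∃ k ∈ occupiedHomes s γ pos (pos v), k < homeIdx s γ (pos v)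
  · refine ⟨.leftRange, ⟨τ, hτ, hEτ, hsubτ⟩, ?_, hfirst⟩
    rintro k ⟨w, hw, rfl⟩ hlt ρ hρ hEρ hsubρ
    rw [← hw.home_eq] at hsubρ
    exact absurd (hmin w ⟨hw.trans hv, ρ, hR v w ρ hρ (hsubρ (mem_home hγ _)),
      (hw.endsLeft_iff ρ).2 hEρ, hsubρ⟩) (not_le.2 hlt)
  · push Not at hfirst
    exact ⟨.leftBoundary, ⟨τ, hτ, hsubτ⟩, hfirst⟩

/-- A node whose home is contained in a known range part is surrounded by two spokesmen. -/
lemma exists_spokesmen_of_home_subset (hγ : 0 < γ)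
    (hpart : ∀ u, ∀ σ ∈ R u, ∃ p, σ ∈ rangeParts s p)
    (hR : ∀ u v, ∀ σ ∈ R u, pos v ∈ σ → σ ∈ R v) {u : V} {σ : Set ℝ} (hσ : σ ∈ R u)
    (hsub : home s γ (pos u) (homeIdx s γ (pos u)) ⊆ σ) :
    ∃ v w, (SameBlock s γ (pos v) (pos u) ∧ homeIdx s γ (pos v) ≤ homeIdx s γ (pos u) ∧
        ∃ κ, IsSpokesman s γ (pos v) (occupiedHomes s γ pos (pos v)) (R v) κ) ∧
      (SameBlock s γ (pos w) (pos u) ∧ homeIdx s γ (pos u) ≤ homeIdx s γ (pos w) ∧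
        ∃ κ, IsSpokesman s γ (pos w) (occupiedHomes s γ pos (pos w)) (R w) κ) := by
  obtain ⟨p, hp⟩ := hpart u σ hσ
  have hu := mem_home (s := s) hγ (pos u)
  by_cases hER : EndsRight s γ (pos u) σ
  · obtain ⟨v, h1, h2, h3⟩ := exists_leftBoundary hγ hR hσ fun k hk => by
      rcases hk.lt_or_eq with hk | rfl
      · exact home_subset_of_endsRight hγ hp hER hk ⟨_, hu, hsub hu⟩
      · exact hsub
    obtain ⟨w, hw⟩ := exists_rightBoundary_or_rightRange hγ hR hσ hER hsub
    exact ⟨v, w, ⟨h1, h2, _, h3⟩, hw⟩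
  by_cases hEL : EndsLeft s γ (pos u) σ
  · obtain ⟨w, h1, h2, h3⟩ := exists_rightBoundary hγ hR hσ fun k hk => by
      rcases hk.lt_or_eq with hk | rfl
      · exact home_subset_of_endsLeft hγ hp hEL hk ⟨_, hu, hsub hu⟩
      · exact hsub
    obtain ⟨v, hv⟩ := exists_leftBoundary_or_leftRange hγ hR hσ hEL hsub
    exact ⟨v, w, hv, h1, h2, _, h3⟩
  -- A part that ends on neither side covers the whole block.
  have hall : ∀ k, home s γ (pos u) k ⊆ σ := fun k y hy => by
    by_contra hyσ
    rcases endsRight_or_endsLeft hp (home_subset_block hγ _ _ hy) hyσ (hsub hu) with h | h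
    · exact hER h
    · exact hEL h
  obtain ⟨v, h1, h2, h3⟩ := exists_leftBoundary hγ hR hσ fun k _ => hall k
  obtain ⟨w, h1', h2', h3'⟩ := exists_rightBoundary hγ hR hσ fun k _ => hall k
  exact ⟨v, w, ⟨h1, h2, _, h3⟩, h1', h2', _, h3'⟩

/-- A node in a known range part is surrounded by two spokesmen. -/
lemma exists_spokesmen (hγ : 0 < γ)
    (hpart : ∀ u, ∀ σ ∈ R u, ∃ p, σ ∈ rangeParts s p)
    (hR : ∀ u v, ∀ σ ∈ R u, pos v ∈ σ → σ ∈ R v) {u : V} {σ : Set ℝ} (hσ : σ ∈ R u)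
    (huσ : pos u ∈ σ) :
    ∃ v w, (SameBlock s γ (pos v) (pos u) ∧ homeIdx s γ (pos v) ≤ homeIdx s γ (pos u) ∧
        ∃ κ, IsSpokesman s γ (pos v) (occupiedHomes s γ pos (pos v)) (R v) κ) ∧
      (SameBlock s γ (pos w) (pos u) ∧ homeIdx s γ (pos u) ≤ homeIdx s γ (pos w) ∧
        ∃ κ, IsSpokesman s γ (pos w) (occupiedHomes s γ pos (pos w)) (R w) κ) := by
  by_cases hsub : ∃ τ ∈ R u, home s γ (pos u) (homeIdx s γ (pos u)) ⊆ τ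
  · obtain ⟨τ, hτ, hsub⟩ := hsub
    exact exists_spokesmen_of_home_subset hγ hpart hR hτ hsub
  -- With no known part containing its home, `u` is itself a potential spokesman and serves on both
  -- sides: a competing home further out that meets a part ending on that side would force the home
  -- of `u` into this part.
  push Not at hsub
  suffices h : ∃ κ, IsSpokesman s γ (pos u) (occupiedHomes s γ pos (pos u)) (R u) κ from
    ⟨u, u, ⟨⟨rfl, rfl⟩, le_rfl, h⟩, ⟨rfl, rfl⟩, le_rfl, h⟩
  have hu := mem_home (s := s) hγ (pos u)
  obtain ⟨p, hp⟩ := hpart u σ hσ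
  obtain ⟨y, hy, hyσ⟩ := Set.not_subset.1 (hsub σ hσ)
  have hP : Partial s γ (pos u) (homeIdx s γ (pos u)) σ := ⟨⟨_, hu, huσ⟩, hsub σ hσ⟩
  rcases endsRight_or_endsLeft hp (home_subset_block hγ _ _ hy) hyσ huσ with hE | hE
  · refine ⟨.rightPotential, ⟨σ, hσ, hE, hP⟩, fun k hk τ hτ hEτ hPτ => hsub τ hτ ?_⟩
    obtain ⟨q, hq⟩ := hpart u τ hτ
    exact home_subset_of_endsRight hγ hq hEτ hk hPτ.1
  · refine ⟨.leftPotential, ⟨σ, hσ, hE, hP⟩, fun k hk τ hτ hEτ hPτ => hsub τ hτ ?_⟩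
    obtain ⟨q, hq⟩ := hpart u τ hτ
    exact home_subset_of_endsLeft hγ hq hEτ hk hPτ.1

end Spokesmen

/-! ### Executions -/

section Execution

variable {V M : Type*}

/-- What the node `v` transmits in round `t` of the execution of `A`. -/
noncomputable def action (A : Protocol M) (s γ : ℝ) (pos : V → ℝ) (own : V → Option M) (t : ℕ)
    (v : V) : Option (Msg M) :=
  A s γ (pos v) (own v) (history A s γ pos own t v)

variable {A : Protocol M} {s γ : ℝ} {pos : V → ℝ} {own : V → Option M}

lemma length_history (t : ℕ) (u : V) : (history A s γ pos own t u).length = t := by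
  induction t with
  | zero => rfl
  | succ t ih => simp [history, ih]

lemma getElem?_history {i t : ℕ} (hit : i < t) (u : V) :
    (history A s γ pos own t u)[i]? = some (receive s pos (action A s γ pos own i) u) := by
  induction t with
  | zero => omega
  | succ t ih =>
    rcases (Nat.lt_succ_iff.1 hit).lt_or_eq with h | rfl
    · rw [history, List.getElem?_append_left (by rwa [length_history]), ih h]
    · rw [history, List.getElem?_append_right (by rw [length_history]), length_history]
      simp only [Nat.sub_self, List.getElem?_cons_zero]
      rfl

lemma mem_history_iff {t : ℕ} {u : V} {r : Option (Msg M)} :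
    r ∈ history A s γ pos own t u ↔ ∃ i < t, receive s pos (action A s γ pos own i) u = r := by
  rw [List.mem_iff_getElem?]
  constructor
  · rintro ⟨i, hi⟩
    have hit : i < t := by
      by_contra h
      rw [List.getElem?_eq_none (by rw [length_history]; omega)] at hi
      cases hi
    rw [getElem?_history hit] at hi
    exact ⟨i, hit, Option.some.inj hi⟩
  · rintro ⟨i, hi, rfl⟩
    exact ⟨i, getElem?_history hi u⟩

variable {act : V → Option (Msg M)} {u v : V}

/-- A message comes through from a node that is the only transmitter within distance `1`. -/
lemma receive_eq_of_unique (hs1 : s < 1) (hadj : (swampGraph s pos).Adj u v)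
    (hv : act v ≠ none) (huniq : ∀ w, |pos u - pos w| ≤ 1 → act w ≠ none → w = v) :
    receive s pos act u = act v := by
  have huniq' : ∀ w, (swampGraph s pos).Adj u w ∧ act w ≠ none → w = v :=
    fun w hw => huniq w hw.1.2.2 hw.2
  have h : act u = none ∧ (∀ v, |pos u - pos v| ≤ s → act v = none) ∧
      ∃! v, (swampGraph s pos).Adj u v ∧ act v ≠ none := by
    refine ⟨?_, fun w hw => ?_, v, ⟨hadj, hv⟩, huniq'⟩
    · by_contra hu
      exact hadj.1 (huniq u (by simp) hu)
    · by_contra hw'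
      have := huniq w (by linarith) hw'
      subst this
      exact absurd hadj.2.1 (not_lt.2 hw)
  rw [receive, dif_pos h, huniq' _ h.2.2.choose_spec.1]

lemma exists_adj_of_receive_eq_some {x : Msg M} (h : receive s pos act u = some x) :
    ∃ v, (swampGraph s pos).Adj u v ∧ act v = some x := by
  unfold receive at h
  split_ifs at h with hc
  exact ⟨_, hc.2.2.choose_spec.1.1, h⟩

lemma receive_eq_none_of_swamped (hv : |pos u - pos v| ≤ s) (hact : act v ≠ none) :
    receive s pos act u = none := by
  rw [receive, dif_neg]
  exact fun h => hact (h.2.1 v hv)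

end Execution

/-! ### Procedure `D*` -/

section Discovery

variable {V M : Type*} {s γ : ℝ} {pos : V → ℝ} {own : V → Option M}

lemma action_algorithmB_of_lt {t : ℕ} (ht : t < dStarRounds s γ) {v : V} :
    (dStarTransmits s γ (pos v) t →
      action (algorithmB M) s γ pos own t v = some Msg.hello) ∧
    (action (algorithmB M) s γ pos own t v ≠ none → dStarTransmits s γ (pos v) t) := by
  simp only [action, algorithmB, length_history, ht, if_true]
  constructor
  · intro h
    rw [if_pos (by rwa [length_history])]
  · intro h
    by_contra h'
    exact h (if_neg (by rwa [length_history]))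

variable (hs : 0 ≤ s) (hs1 : s < 1) (hγ : 0 < γ) (hγ1 : γ ≤ 1)
  (hsep : ∀ u v : V, u ≠ v → γ ≤ |pos u - pos v|)

include hs hγ hγ1 hsep

lemma eq_of_label_eq {u v w : V} (hv : |pos u - pos v| ≤ 1) (hw : |pos u - pos w| ≤ 1)
    (h : label s γ (pos v) = label s γ (pos w)) : v = w := by
  have hvw : |pos v - pos w| ≤ 2 := by
    have := abs_sub_le (pos v) (pos u) (pos w)
    rw [abs_sub_comm (pos v) (pos u)] at this
    linarith
  obtain ⟨hb, hh⟩ := Prod.mk.inj h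
  exact eq_of_homeIdx_eq hγ hsep (sameBlock_of_abs_sub_le_two hs hγ hγ1 hb hvw) hh

include hs1

/-- At most one node within distance 1 of `u` transmits in a round of Procedure `D`, so a neighbour
cannot be drowned out, and only neighbours are ever heard. -/
lemma mem_heardLabels_iff {t : ℕ} (ht : dStarRounds s γ ≤ t) {u : V} {c : ℕ × ℕ} :
    c ∈ heardLabels s γ (history (algorithmB M) s γ pos own t u) ↔
      ∃ v, (swampGraph s pos).Adj u v ∧ label s γ (pos v) = c := by
  have hL : numLabels s γ ≤ dStarRounds s γ := Nat.le_add_right _ _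
  constructor
  · rintro ⟨i, hi, rfl, hr⟩
    rw [getElem?_history (by omega)] at hr
    obtain ⟨v, hadj, hv⟩ := exists_adj_of_receive_eq_some (Option.some.inj hr)
    have := (action_algorithmB_of_lt (hi.trans_le hL)).2 (by rw [hv]; simp)
    rcases this with h | h
    · exact ⟨v, hadj, h.2⟩
    · omega
  · rintro ⟨v, hadj, rfl⟩
    have hi := labelIndex_lt (s := s) hγ (pos v)
    refine ⟨labelIndex s γ (pos v), hi, loopLabel_labelIndex hγ _, ?_⟩
    have hact := (action_algorithmB_of_lt (M := M) (own := own) (pos := pos) (v := v)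
      (hi.trans_le hL)).1 (Or.inl ⟨hi, (loopLabel_labelIndex hγ _).symm⟩)
    rw [getElem?_history (by omega), receive_eq_of_unique hs1 hadj (by rw [hact]; simp) _,
      hact]
    intro w hw hwact
    rcases (action_algorithmB_of_lt (hi.trans_le hL)).2 hwact with h | h
    · rw [loopLabel_labelIndex hγ] at h
      exact eq_of_label_eq hs hγ hγ1 hsep hw hadj.2.2 h.2
    · omega

/-- After Procedure `D*` each node knows exactly the labels of the other nodes within
distance `1`. -/
lemma knownLabels_eq (hconn : (swampGraph s pos).Connected) {t : ℕ} (ht : dStarRounds s γ ≤ t)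
    (u : V) : knownLabels s γ (pos u) (history (algorithmB M) s γ pos own t u) =
      {a | ∃ v : V, v ≠ u ∧ |pos u - pos v| ≤ 1 ∧ label s γ (pos v) = a} := by
  ext c
  constructor
  · rintro (hc | ⟨j, hj, rfl, hheard, hlisten, hr⟩)
    · obtain ⟨v, hadj, rfl⟩ := (mem_heardLabels_iff hs hs1 hγ hγ1 hsep ht).1 hc
      exact ⟨v, hadj.1.symm, hadj.2.2, rfl⟩
    · obtain ⟨v, hadj, hv⟩ := (mem_heardLabels_iff hs hs1 hγ hγ1 hsep ht).1 hheard
      -- Without another node of the tested label within distance 1, the neighbour `v` would be the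
      -- only transmitter there and would be heard.
      by_contra hno
      have hlt : numLabels s γ + j < dStarRounds s γ := Nat.add_lt_add_left hj _
      have hact := (action_algorithmB_of_lt (M := M) (own := own) (pos := pos) (v := v)
        hlt).1 (Or.inr ⟨by omega, Or.inl (by rw [hv, Nat.add_sub_cancel_left])⟩)
      rw [getElem?_history (by omega), receive_eq_of_unique hs1 hadj (by rw [hact]; simp) _,
        hact] at hr
      · simp at hr
      · intro w hw hwact
        have hwT := (action_algorithmB_of_lt hlt).2 hwact
        rcases hwT with h | ⟨-, h⟩
        · omega
        rw [Nat.add_sub_cancel_left] at h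
        rcases h with h | h
        · exact eq_of_label_eq hs hγ hγ1 hsep hw hadj.2.2 (h.trans hv.symm)
        · exfalso
          refine hno ⟨w, ?_, hw, h⟩
          rintro rfl
          exact hlisten ((action_algorithmB_of_lt hlt).2 hwact)
  · rintro ⟨v, hne, hv, rfl⟩
    rcases lt_or_ge s |pos u - pos v| with hsv | hsv
    · exact Or.inl ((mem_heardLabels_iff hs hs1 hγ hγ1 hsep ht).2 ⟨v, ⟨hne.symm, hsv, hv⟩, rfl⟩)
    · right
      -- Connectivity supplies a neighbour as probe; the decisive round has `w` in the outer and `v`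
      -- in the inner loop.
      obtain ⟨w, hw⟩ : ∃ w, (swampGraph s pos).Adj u w := by
        obtain ⟨p⟩ := hconn.preconnected u v
        cases p with
        | nil => exact absurd rfl hne
        | cons h _ => exact ⟨_, h⟩
      have hi := labelIndex_lt (s := s) hγ (pos v)
      have hk := labelIndex_lt (s := s) hγ (pos w)
      have hL : 0 < numLabels s γ := by omega
      have hdiv : (numLabels s γ * labelIndex s γ (pos w) + labelIndex s γ (pos v)) /
          numLabels s γ = labelIndex s γ (pos w) := by
        rw [Nat.mul_add_div hL, Nat.div_eq_of_lt hi, add_zero]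
      have hmod : (numLabels s γ * labelIndex s γ (pos w) + labelIndex s γ (pos v)) %
          numLabels s γ = labelIndex s γ (pos v) := by
        rw [Nat.mul_add_mod, Nat.mod_eq_of_lt hi]
      have hj : numLabels s γ * labelIndex s γ (pos w) + labelIndex s γ (pos v) <
          numLabels s γ ^ 2 := by
        have : numLabels s γ * (labelIndex s γ (pos w) + 1) ≤ numLabels s γ * numLabels s γ :=
          Nat.mul_le_mul_left _ hk
        rw [sq]
        linarith
      generalize numLabels s γ * labelIndex s γ (pos w) + labelIndex s γ (pos v) = j at *
      have hlt : numLabels s γ + j < dStarRounds s γ := Nat.add_lt_add_left hj _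
      refine ⟨j, hj, by rw [hmod, loopLabel_labelIndex hγ],
        (mem_heardLabels_iff hs hs1 hγ hγ1 hsep ht).2
          ⟨w, hw, by rw [hdiv, loopLabel_labelIndex hγ]⟩, ?_, ?_⟩
      -- `u` listens in that round, since it shares its label with neither `w` nor `v`.
      · rintro (h | ⟨-, h⟩)
        · omega
        rw [Nat.add_sub_cancel_left, hmod, hdiv, loopLabel_labelIndex hγ,
          loopLabel_labelIndex hγ] at h
        rcases h with h | h
        · exact hw.1 (eq_of_label_eq hs hγ hγ1 hsep (by simp) hw.2.2 h)
        · exact hne (eq_of_label_eq hs hγ hγ1 hsep (by simp) hv h).symm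
      · have hact := (action_algorithmB_of_lt (M := M) (own := own) (pos := pos) (v := v)
          hlt).1 (Or.inr ⟨by omega, Or.inr (by
            rw [Nat.add_sub_cancel_left, hmod, loopLabel_labelIndex hγ])⟩)
        rw [getElem?_history (by omega), receive_eq_none_of_swamped hsv (by rw [hact]; simp)]

/-- Blocks have length at most 1, so discovery up to distance 1 sees the whole block. -/
lemma occupied_eq (hconn : (swampGraph s pos).Connected) {t : ℕ} (ht : dStarRounds s γ ≤ t)
    (u : V) : occupied s γ (pos u) (history (algorithmB M) s γ pos own t u) =
      occupiedHomes s γ pos (pos u) := by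
  ext k
  simp only [occupied, knownLabels_eq hs hs1 hγ hγ1 hsep hconn ht, Set.mem_ofPred_eq,
    occupiedHomes, label]
  constructor
  · rintro (rfl | ⟨v, -, hv, h⟩)
    · exact ⟨u, ⟨rfl, rfl⟩, rfl⟩
    · obtain ⟨hb, hk⟩ := Prod.mk.inj h
      refine ⟨v, sameBlock_of_abs_sub_le_two hs hγ hγ1 hb ?_, hk⟩
      rw [abs_sub_comm]
      linarith
  · rintro ⟨v, hv, rfl⟩
    by_cases hvu : v = u
    · exact Or.inl (by rw [hvu])
    · have := hv.symm.abs_sub_lt hγ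
      have := blockLen_le_one hs hγ1
      exact Or.inr ⟨v, hvu, by linarith, by rw [hv.2]⟩

end Discovery

/-! ### Procedure `T` -/

section Dissemination

variable {M : Type*}

lemma eq_or_mem_of_knownMessage {own : Option M} {h : History M} {m : M}
    (hk : knownMessage own h = some m) : own = some m ∨ ∃ p, some (Msg.data m p) ∈ h := by
  cases own with
  | some a => exact Or.inl hk
  | none =>
    right
    have hk' : h.findSome? _ = some m := hk
    obtain ⟨r, hr, hrm⟩ := List.exists_of_findSome?_eq_some hk'
    rcases r with _ | _ | ⟨a, p⟩
    · cases hrm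
    · cases hrm
    · cases hrm
      exact ⟨p, hr⟩

lemma knownMessage_ne_none {own : Option M} {h : History M} {m : M} {p : ℝ}
    (hm : some (Msg.data m p) ∈ h) : knownMessage own h ≠ none := by
  cases own with
  | some a => exact fun h => by cases h
  | none =>
    intro hk
    have hk' : h.findSome? _ = none := hk
    have := List.findSome?_eq_none_iff.1 hk' _ hm
    cases this

/-- Ensures that a spokesman has received the message it is to transmit. -/
lemma IsSpokesman.nonempty {s γ x : ℝ} {O : Set ℕ} {R : Set (Set ℝ)} {κ : Kind}
    (h : IsSpokesman s γ x O R κ) : R.Nonempty := by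
  cases κ <;> exact ⟨h.1.choose, h.1.choose_spec.1⟩

lemma exists_kindOf_eq (κ : Kind) : ∃ k < 6, kindOf k = κ := by
  cases κ
  · exact ⟨0, by norm_num, rfl⟩
  · exact ⟨1, by norm_num, rfl⟩
  · exact ⟨2, by norm_num, rfl⟩
  · exact ⟨3, by norm_num, rfl⟩
  · exact ⟨4, by norm_num, rfl⟩
  · exact ⟨5, by norm_num, rfl⟩

variable {V : Type*} {s γ : ℝ} {pos : V → ℝ} {src : V} {m : M}

lemma exists_mem_rangeParts {p x : ℝ} (h : s < |x - p|) (h' : |x - p| ≤ 1) :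
    ∃ σ ∈ rangeParts s p, x ∈ σ := by
  obtain ⟨h1, h2⟩ := abs_le.1 h'
  rcases lt_abs.1 h with h | h
  · exact ⟨_, Or.inr rfl, by linarith, by linarith⟩
  · exact ⟨_, Or.inl rfl, by linarith, by linarith⟩

lemma adj_of_mem_rangeParts (hs : 0 ≤ s) {u v : V} {σ : Set ℝ} (hσ : σ ∈ rangeParts s (pos v))
    (hu : pos u ∈ σ) : (swampGraph s pos).Adj u v := by
  have h : s < |pos u - pos v| ∧ |pos u - pos v| ≤ 1 := by
    rcases hσ with rfl | rfl
    · obtain ⟨h1, h2⟩ := hu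
      exact ⟨lt_abs.2 (Or.inr (by linarith)), abs_le.2 ⟨by linarith, by linarith⟩⟩
    · obtain ⟨h1, h2⟩ := hu
      exact ⟨lt_abs.2 (Or.inl (by linarith)), abs_le.2 ⟨by linarith, by linarith⟩⟩
  refine ⟨?_, h⟩
  rintro rfl
  simp only [sub_self, abs_zero] at h
  linarith

/-- What `v` transmits in round `t` of Algorithm `B` with source `src` and message `m`. -/
noncomputable abbrev sent (s γ : ℝ) (pos : V → ℝ) (src : V) (m : M) (t : ℕ) (v : V) :
    Option (Msg M) :=
  action (algorithmB M) s γ pos (sourceInput src m) t v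

/-- The history of `v` after `t` rounds of Algorithm `B` with source `src` and message `m`. -/
noncomputable abbrev hist (s γ : ℝ) (pos : V → ℝ) (src : V) (m : M) (t : ℕ) (v : V) : History M :=
  history (algorithmB M) s γ pos (sourceInput src m) t v

lemma sent_dStarRounds (v : V) : sent s γ pos src m (dStarRounds s γ) v =
    (sourceInput src m v).map fun a => Msg.data a (pos v) := by
  simp [sent, action, algorithmB, length_history]

open Classical in
lemma sent_dStarRounds_add (i : ℕ) (v : V) :
    sent s γ pos src m (dStarRounds s γ + 1 + i) v =
      if tTransmits s γ (pos v) (hist s γ pos src m (dStarRounds s γ + 1 + i) v) i then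
        (knownMessage (sourceInput src m v)
          (hist s γ pos src m (dStarRounds s γ + 1 + i) v)).map fun a => Msg.data a (pos v)
      else none := by
  have hl := length_history (A := algorithmB M) (s := s) (γ := γ) (pos := pos)
    (own := sourceInput src m) (dStarRounds s γ + 1 + i) v
  unfold sent action hist
  rw [show algorithmB M s γ (pos v) (sourceInput src m v) (history (algorithmB M) s γ pos
    (sourceInput src m) (dStarRounds s γ + 1 + i) v) = _ from if_neg (by omega),
    if_neg (by omega)]
  have hi : (history (algorithmB M) s γ pos (sourceInput src m) (dStarRounds s γ + 1 + i) v).length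
      - (dStarRounds s γ + 1) = i := by omega
  rw [hi]

lemma dStarRounds_le_of_sent_eq_data {t : ℕ} {v : V} {a : M} {p : ℝ}
    (h : sent s γ pos src m t v = some (Msg.data a p)) : dStarRounds s γ ≤ t := by
  by_contra! ht
  have hne : sent s γ pos src m t v ≠ none := by simp [h]
  have : sent s γ pos src m t v = some Msg.hello :=
    (action_algorithmB_of_lt ht).1 ((action_algorithmB_of_lt ht).2 hne)
  cases h.symm.trans this

lemma sourceInput_eq_some {v : V} {a : M} (h : sourceInput src m v = some a) : v = src ∧ a = m := by
  unfold sourceInput at h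
  split_ifs at h with hv
  exact ⟨hv, (Option.some.inj h).symm⟩

/-- All data messages carry the source message and the location of the sender. -/
lemma eq_of_sent_eq_data (t : ℕ) : ∀ (v : V) (a : M) (p : ℝ),
    sent s γ pos src m t v = some (Msg.data a p) → a = m ∧ p = pos v := by
  induction t using Nat.strong_induction_on with
  | _ t ih =>
    intro v a p h
    rcases (dStarRounds_le_of_sent_eq_data h).eq_or_lt with rfl | ht
    · rw [sent_dStarRounds, Option.map_eq_some_iff] at h
      obtain ⟨b, hb, hba⟩ := h
      cases hba
      exact ⟨(sourceInput_eq_some hb).2, rfl⟩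
    · obtain ⟨i, rfl⟩ := Nat.exists_eq_add_of_le (Nat.succ_le_of_lt ht)
      rw [Nat.succ_eq_add_one, sent_dStarRounds_add] at h
      split_ifs at h
      rw [Option.map_eq_some_iff] at h
      obtain ⟨b, hb, hba⟩ := h
      cases hba
      refine ⟨?_, rfl⟩
      rcases eq_or_mem_of_knownMessage hb with hb | ⟨q, hq⟩
      · exact (sourceInput_eq_some hb).2
      · obtain ⟨j, hj, hr⟩ := mem_history_iff.1 hq
        obtain ⟨w, -, hw⟩ := exists_adj_of_receive_eq_some hr
        exact (ih j hj w a q hw).1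

lemma sent_eq_data {t : ℕ} (ht : dStarRounds s γ ≤ t) {v : V}
    (h : sent s γ pos src m t v ≠ none) :
    sent s γ pos src m t v = some (Msg.data m (pos v)) := by
  obtain ⟨a, ha⟩ : ∃ a, sent s γ pos src m t v = some (Msg.data a (pos v)) := by
    rcases ht.eq_or_lt with rfl | ht
    · rw [sent_dStarRounds] at h ⊢
      cases hb : sourceInput src m v with
      | none => simp [hb] at h
      | some b => exact ⟨b, rfl⟩
    · obtain ⟨i, rfl⟩ := Nat.exists_eq_add_of_le (Nat.succ_le_of_lt ht)
      rw [Nat.succ_eq_add_one, sent_dStarRounds_add] at h ⊢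
      by_cases hT : tTransmits s γ (pos v) (hist s γ pos src m (dStarRounds s γ + 1 + i) v) i
      swap
      · simp [hT] at h
      rw [if_pos hT] at h ⊢
      cases hb : knownMessage (sourceInput src m v)
        (hist s γ pos src m (dStarRounds s γ + 1 + i) v) with
      | none => simp [hb] at h
      | some b => exact ⟨b, rfl⟩
  rw [ha, (eq_of_sent_eq_data t v a _ ha).1]

/-- The parts of the ranges of those neighbours of `u` that transmitted the source message before
round `t`. -/
def sentRanges (s γ : ℝ) (pos : V → ℝ) (src : V) (m : M) (t : ℕ) (u : V) : Set (Set ℝ) :=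
  {σ | ∃ i < t, ∃ v, dStarRounds s γ ≤ i ∧ sent s γ pos src m i v ≠ none ∧
    (swampGraph s pos).Adj u v ∧ σ ∈ rangeParts s (pos v)}

lemma exists_mem_rangeParts_of_mem_sentRanges {t : ℕ} {u : V} {σ : Set ℝ}
    (h : σ ∈ sentRanges s γ pos src m t u) : ∃ p, σ ∈ rangeParts s p := by
  obtain ⟨-, -, v, -, -, -, h⟩ := h
  exact ⟨_, h⟩

/-- The locality hypothesis `hR` of the existence lemmas: any node inside a part is a neighbour of
its sender. -/
lemma mem_sentRanges_of_mem (hs : 0 ≤ s) {t : ℕ} {u v : V} {σ : Set ℝ}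
    (h : σ ∈ sentRanges s γ pos src m t u) (hv : pos v ∈ σ) :
    σ ∈ sentRanges s γ pos src m t v := by
  obtain ⟨i, hi, w, hD, hw, -, h⟩ := h
  exact ⟨i, hi, w, hD, hw, adj_of_mem_rangeParts hs h hv, h⟩

/-- In round `t` no two transmitters are within distance `2` of each other. -/
def Uncrowded (s γ : ℝ) (pos : V → ℝ) (src : V) (m : M) (t : ℕ) : Prop :=
  ∀ v w, sent s γ pos src m t v ≠ none → sent s γ pos src m t w ≠ none →
    |pos v - pos w| ≤ 2 → v = w

lemma Uncrowded.receive_eq (hs1 : s < 1) {t : ℕ} (ht : dStarRounds s γ ≤ t)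
    (hU : Uncrowded s γ pos src m t) {u v : V} (hv : sent s γ pos src m t v ≠ none)
    (hadj : (swampGraph s pos).Adj u v) :
    receive s pos (sent s γ pos src m t) u = some (Msg.data m (pos v)) := by
  rw [receive_eq_of_unique hs1 hadj hv, sent_eq_data ht hv]
  intro w hw hact
  refine hU w v hact hv ?_
  have := abs_sub_le (pos w) (pos u) (pos v)
  rw [abs_sub_comm (pos w) (pos u)] at this
  linarith [hadj.2.2]

/-- Without collisions, what `u` heard is determined by who transmitted nearby; this replaces
histories by a description to which locality applies. -/
lemma heardRanges_eq_sentRanges (hs1 : s < 1) {t₀ t : ℕ} (ht : t₀ ≤ t)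
    (hU : ∀ i < t₀, dStarRounds s γ ≤ i → Uncrowded s γ pos src m i) (u : V) :
    heardRanges s (hist s γ pos src m t u) t₀ = sentRanges s γ pos src m t₀ u := by
  ext σ
  constructor
  · rintro ⟨i, hi, a, p, hr, hσ⟩
    rw [getElem?_history (hi.trans_le ht)] at hr
    obtain ⟨v, hadj, hv⟩ := exists_adj_of_receive_eq_some (Option.some.inj hr)
    obtain ⟨rfl, rfl⟩ := eq_of_sent_eq_data i v a p hv
    exact ⟨i, hi, v, dStarRounds_le_of_sent_eq_data hv, by rw [sent, hv]; simp, hadj, hσ⟩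
  · rintro ⟨i, hi, v, hD, hv, hadj, hσ⟩
    refine ⟨i, hi, m, pos v, ?_, hσ⟩
    rw [getElem?_history (hi.trans_le ht), (hU i hi hD).receive_eq hs1 hD hv hadj]

lemma informed_mono {t t' : ℕ} (h : t ≤ t') {u : V}
    (hu : Informed (algorithmB M) s γ pos src m t u) :
    Informed (algorithmB M) s γ pos src m t' u := by
  refine hu.imp_right ?_
  rintro ⟨p, hp⟩
  obtain ⟨i, hi, hr⟩ := mem_history_iff.1 hp
  exact ⟨p, mem_history_iff.2 ⟨i, hi.trans_le h, hr⟩⟩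

/-! ### Absence of collisions and progress per sweep. -/

variable (hs : 0 ≤ s) (hs1 : s < 1) (hγ : 0 < γ) (hγ1 : γ ≤ 1)
  (hsep : ∀ u v : V, u ≠ v → γ ≤ |pos u - pos v|) (hconn : (swampGraph s pos).Connected)

include hs hs1 hγ hγ1 hsep hconn

open Classical in
-- A status depends on earlier rounds only, and these are uncrowded by induction. Transmitters
-- within distance 2 in the same round share a block and a kind, so uniqueness of spokesmen applies.
lemma uncrowded (t : ℕ) (ht : dStarRounds s γ ≤ t) : Uncrowded s γ pos src m t := by
  induction t using Nat.strong_induction_on with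
  | _ t ih =>
    intro v w hv hw hvw
    rcases ht.eq_or_lt with rfl | ht'
    · rw [sent_dStarRounds, Option.ne_none_iff_exists'] at hv hw
      obtain ⟨a, ha⟩ := hv
      obtain ⟨b, hb⟩ := hw
      obtain ⟨a', ha', -⟩ := Option.map_eq_some_iff.1 ha
      obtain ⟨b', hb', -⟩ := Option.map_eq_some_iff.1 hb
      rw [(sourceInput_eq_some ha').1, (sourceInput_eq_some hb').1]
    · obtain ⟨i, rfl⟩ := Nat.exists_eq_add_of_le (Nat.succ_le_of_lt ht')
      rw [Nat.succ_eq_add_one] at *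
      rw [sent_dStarRounds_add] at hv hw
      obtain ⟨⟨hbv, hv'⟩, -⟩ := ite_ne_right_iff.1 hv
      obtain ⟨⟨hbw, hw'⟩, -⟩ := ite_ne_right_iff.1 hw
      have hB := sameBlock_of_abs_sub_le_two hs hγ hγ1 (hbv.trans hbw.symm) hvw
      -- The cut-off `i - i % 6` is the start of the six rounds, where the status is fixed.
      have hH := heardRanges_eq_sentRanges (src := src) (m := m) (pos := pos) hs1
        (t₀ := dStarRounds s γ + 1 + (i - i % 6)) (t := dStarRounds s γ + 1 + i) (by omega)
        (fun j hj hD => ih j (by omega) hD)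
      rw [hH, occupied_eq hs hs1 hγ hγ1 hsep hconn ht] at hv' hw'
      rw [hB.occupiedHomes_eq] at hv'
      have hvO : homeIdx s γ (pos v) ∈ occupiedHomes s γ pos (pos w) := ⟨v, hB, rfl⟩
      have hwO : homeIdx s γ (pos w) ∈ occupiedHomes s γ pos (pos w) := ⟨w, ⟨rfl, rfl⟩, rfl⟩
      have hP := fun (u : V) (σ : Set ℝ) => exists_mem_rangeParts_of_mem_sentRanges (s := s)
        (γ := γ) (pos := pos) (src := src) (m := m)
        (t := dStarRounds s γ + 1 + (i - i % 6)) (u := u) (σ := σ)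
      exact eq_of_homeIdx_eq hγ hsep hB (le_antisymm
        (IsSpokesman.homeIdx_le hγ hB.symm hwO hvO (hP w) (hP v)
          (fun σ h1 h2 => mem_sentRanges_of_mem hs h1 h2)
          (fun σ h1 h2 => mem_sentRanges_of_mem hs h1 h2) hw' hv')
        (IsSpokesman.homeIdx_le hγ hB hvO hwO (hP v) (hP w)
          (fun σ h1 h2 => mem_sentRanges_of_mem hs h1 h2)
          (fun σ h1 h2 => mem_sentRanges_of_mem hs h1 h2) hv' hw'))

/-- A neighbour of a transmitter receives the message. -/
lemma mem_history_of_sent {i t : ℕ} (hi : dStarRounds s γ ≤ i) (hit : i < t) {u v : V}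
    (hv : sent s γ pos src m i v ≠ none) (hadj : (swampGraph s pos).Adj u v) :
    some (Msg.data m (pos v)) ∈ hist s γ pos src m t u :=
  mem_history_iff.2
    ⟨i, hit, (uncrowded hs hs1 hγ hγ1 hsep hconn i hi).receive_eq hs1 hi hv hadj⟩

/-- A spokesman transmits in the round of its block and its kind in each sweep. -/
lemma sent_ne_none_of_isSpokesman {n k : ℕ} (hk : k < 6) {v : V}
    (hv : IsSpokesman s γ (pos v) (occupiedHomes s γ pos (pos v))
      (sentRanges s γ pos src m
        (dStarRounds s γ + 1 + (6 * numBlocks s γ * n + 6 * blockIdx s γ (pos v))) v)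
      (kindOf k)) :
    sent s γ pos src m
      (dStarRounds s γ + 1 + (6 * numBlocks s γ * n + 6 * blockIdx s γ (pos v) + k)) v ≠ none := by
  have hb := blockIdx_lt (s := s) hγ (pos v)
  obtain ⟨i, hi⟩ : ∃ i, i = 6 * numBlocks s γ * n + 6 * blockIdx s γ (pos v) + k := ⟨_, rfl⟩
  have h1 : i % (6 * numBlocks s γ) / 6 = blockIdx s γ (pos v) := by
    rw [hi, add_assoc, Nat.mul_add_mod, Nat.mod_eq_of_lt (by omega)]
    omega
  have h2 : i % 6 = k := by
    rw [hi, mul_assoc]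
    omega
  have h3 : i - i % 6 = 6 * numBlocks s γ * n + 6 * blockIdx s γ (pos v) := by omega
  rw [← hi, sent_dStarRounds_add, if_pos]
  · obtain ⟨σ, j, hj, w, hD, hw, hadj, -⟩ := hv.nonempty
    have := knownMessage_ne_none (own := sourceInput src m v)
      (mem_history_of_sent hs hs1 hγ hγ1 hsep hconn hD
        (show j < dStarRounds s γ + 1 + i by omega) hw hadj)
    simpa using this
  · refine ⟨h1.symm, ?_⟩
    rw [h3, h2, occupied_eq hs hs1 hγ hγ1 hsep hconn (by omega),
      heardRanges_eq_sentRanges hs1 (by omega)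
        (fun j _ hD => uncrowded hs hs1 hγ hγ1 hsep hconn j hD)]
    exact hv

/-- In each sweep the message reaches all neighbours of the nodes that received it before. -/
lemma received_of_adj [Finite V] {n : ℕ} {u w : V} (hadj : (swampGraph s pos).Adj w u)
    (hu : ∃ p, some (Msg.data m p) ∈
      hist s γ pos src m (dStarRounds s γ + 1 + 6 * numBlocks s γ * n) u) :
    ∃ p, some (Msg.data m p) ∈
      hist s γ pos src m (dStarRounds s γ + 1 + 6 * numBlocks s γ * (n + 1)) w := by
  obtain ⟨p, hp⟩ := hu
  obtain ⟨i, hi, hr⟩ := mem_history_iff.1 hp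
  obtain ⟨v, huv, hv⟩ := exists_adj_of_receive_eq_some hr
  obtain ⟨σ, hσ, huσ⟩ := exists_mem_rangeParts huv.2.1 huv.2.2
  have hb := blockIdx_lt (s := s) hγ (pos u)
  have hσR : σ ∈ sentRanges s γ pos src m
      (dStarRounds s γ + 1 + (6 * numBlocks s γ * n + 6 * blockIdx s γ (pos u))) u :=
    ⟨i, by omega, v, dStarRounds_le_of_sent_eq_data hv, by rw [sent, hv]; simp, huv, hσ⟩
  have key : ∀ x, SameBlock s γ (pos x) (pos u) → (∃ κ, IsSpokesman s γ (pos x)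
      (occupiedHomes s γ pos (pos x)) (sentRanges s γ pos src m
        (dStarRounds s γ + 1 + (6 * numBlocks s γ * n + 6 * blockIdx s γ (pos u))) x) κ) →
      (swampGraph s pos).Adj w x → ∃ p, some (Msg.data m p) ∈
      hist s γ pos src m (dStarRounds s γ + 1 + 6 * numBlocks s γ * (n + 1)) w := by
    rintro x hx ⟨κ, hκ⟩ hwx
    obtain ⟨k, hk, rfl⟩ := exists_kindOf_eq κ
    rw [← hx.2] at hκ hb
    refine ⟨_, mem_history_of_sent hs hs1 hγ hγ1 hsep hconn ?_ ?_
      (sent_ne_none_of_isSpokesman hs hs1 hγ hγ1 hsep hconn hk hκ) hwx⟩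
    · omega
    · rw [mul_add]
      omega
  obtain ⟨a, b, ⟨ha, hau, hak⟩, ⟨hb', hub, hbk⟩⟩ := exists_spokesmen hγ
    (fun u σ h => exists_mem_rangeParts_of_mem_sentRanges h)
    (fun u v σ h h' => mem_sentRanges_of_mem hs h h') hσR huσ
  -- A block is shorter than needed only when `γ ≤ 1 - s`; otherwise separation forces `a = b`.
  have hab : pos b < pos a + (1 - s) := by
    rcases le_total γ (1 - s) with h | h
    · have := (hb'.trans ha.symm).abs_sub_lt hγ
      rw [blockLen, max_eq_left h, abs_sub_lt_iff] at this
      linarith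
    · have hlt := (hb'.trans ha.symm).abs_sub_lt hγ
      rw [blockLen, max_eq_right h] at hlt
      have : b = a := by
        by_contra hne
        exact absurd (hsep b a hne) (not_le.2 hlt)
      rw [this]
      linarith
  have hne : ∀ x, s < |pos w - pos x| → w ≠ x := by
    rintro x hx rfl
    simp only [sub_self, abs_zero] at hx
    linarith
  rcases in_range_of_between hs (pos_le_of_homeIdx_le hγ hsep ha hau)
    (pos_le_of_homeIdx_le hγ hsep hb'.symm hub) hab hadj.2.1 hadj.2.2 with h | h
  · exact key a ha hak ⟨hne a h.1, h⟩
  · exact key b hb' hbk ⟨hne b h.1, h⟩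

/-- A node at the end of a walk of length `n` is informed after `n` sweeps. -/
lemma informed_of_walk [Finite V] {u : V} (p : (swampGraph s pos).Walk u src) :
    Informed (algorithmB M) s γ pos src m
      (dStarRounds s γ + 1 + 6 * numBlocks s γ * p.length) u := by
  induction p with
  | nil => exact Or.inl rfl
  | @cons w u src hadj p ih =>
    right
    -- The source may never receive the message and so never become a spokesman; its neighbours are
    -- served by the opening round of Procedure `T`.
    rcases ih with rfl | h
    · refine ⟨_, mem_history_of_sent hs hs1 hγ hγ1 hsep hconn le_rfl (by omega)
        (v := u) ?_ hadj⟩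
      rw [sent_dStarRounds]
      simp [sourceInput]
    · exact received_of_adj hs hs1 hγ hγ1 hsep hconn hadj h

lemma informed_of_diam [Finite V] (u : V) :
    Informed (algorithmB M) s γ pos src m
      (dStarRounds s γ + 1 + 6 * numBlocks s γ * (swampGraph s pos).diam) u := by
  obtain ⟨p, hp⟩ := hconn.exists_walk_length_eq_dist u src
  have hle : p.length ≤ (swampGraph s pos).diam := by
    rw [hp]
    have := hconn.nonempty
    exact SimpleGraph.dist_le_diam (SimpleGraph.connected_iff_ediam_ne_top.1 hconn)
  exact informed_mono (by gcongr)
    (informed_of_walk hs hs1 hγ hγ1 hsep hconn p)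

end Dissemination

/-! ### Numerical bounds -/

section Bounds

variable {s γ : ℝ}

lemma numBlocks_le (hs : 0 ≤ s) (hγ : 0 < γ) (hγ1 : γ ≤ 1) :
    (numBlocks s γ : ℝ) ≤ 4 / blockLen s γ := by
  have hl := blockLen_pos (s := s) hγ
  have h := (Nat.ceil_lt_add_one (div_nonneg zero_le_three hl.le)).le
  have h1 : 1 ≤ 1 / blockLen s γ := (one_le_div hl).2 (blockLen_le_one hs hγ1)
  calc (numBlocks s γ : ℝ) ≤ 3 / blockLen s γ + 1 := h
    _ ≤ 3 / blockLen s γ + 1 / blockLen s γ := by gcongr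
    _ = 4 / blockLen s γ := by ring

/-- Rounding up costs only constant factors, because `l ≤ 1` and `γ ≤ l`; the block length then
cancels. -/
lemma numLabels_le (hs : 0 ≤ s) (hγ : 0 < γ) (hγ1 : γ ≤ 1) :
    (numLabels s γ : ℝ) ≤ 8 * (1 / γ) := by
  have hl := blockLen_pos (s := s) hγ
  have h : (numHomes s γ : ℝ) ≤ 2 * (blockLen s γ / γ) := by
    have h1 := (Nat.ceil_lt_add_one (div_nonneg hl.le hγ.le)).le
    have h2 : 1 ≤ blockLen s γ / γ := (one_le_div hγ).2 (le_max_right _ _)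
    unfold numHomes
    linarith
  calc (numLabels s γ : ℝ) = numBlocks s γ * numHomes s γ := by simp [numLabels]
    _ ≤ (4 / blockLen s γ) * (2 * (blockLen s γ / γ)) := by
      gcongr
      exact numBlocks_le hs hγ hγ1
    _ = 8 * (1 / γ) := by
      field_simp
      norm_num

lemma le_numLabels (hγ : 0 < γ) : 3 * (1 / γ) ≤ (numLabels s γ : ℝ) := by
  have hl := blockLen_pos (s := s) hγ
  calc 3 * (1 / γ) = (3 / blockLen s γ) * (blockLen s γ / γ) := by field_simp
    _ ≤ numBlocks s γ * numHomes s γ := by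
      gcongr
      · exact Nat.le_ceil _
      · exact Nat.le_ceil _
    _ = numLabels s γ := by simp [numLabels]

end Bounds

end Highway

/-! ### Constants and assembly. -/

theorem theorem2 :
    ∃ c C : ℝ, 0 < c ∧ 0 < C ∧
      ∀ (s γ : ℝ), 0 ≤ s → s < 1 → 0 < γ → γ ≤ 1 →
      ∀ (V : Type*) [Finite V] (pos : V → ℝ),
        (∀ u v : V, u ≠ v → γ ≤ |pos u - pos v|) →
        (Highway.swampGraph s pos).Connected →
      ∀ (M : Type*) (src : V) (m : M),
        -- Procedure `D*` takes `Θ(g²)` rounds, where `g = 1 / γ`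
        c * (1 / γ) ^ 2 ≤ (Highway.dStarRounds s γ : ℝ) ∧
        (Highway.dStarRounds s γ : ℝ) ≤ C * (1 / γ) ^ 2 ∧
        -- and after it each node knows exactly the other nodes within distance `1`
        (∀ u : V, Highway.knownLabels s γ (pos u)
            (Highway.history (Highway.algorithmB M) s γ pos (Highway.sourceInput src m)
              (Highway.dStarRounds s γ) u) =
          {a | ∃ v : V, v ≠ u ∧ |pos u - pos v| ≤ 1 ∧ Highway.label s γ (pos v) = a}) ∧
        -- Procedure `T` then informs all nodes within `O(D / l)` rounds,
        -- and Algorithm `B` takes `O(D / l + g²)` rounds altogether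
        ∃ T : ℕ,
          (T : ℝ) ≤ C * ((Highway.swampGraph s pos).diam / max (1 - s) γ) ∧
          ((Highway.dStarRounds s γ + T : ℕ) : ℝ) ≤
            C * ((Highway.swampGraph s pos).diam / max (1 - s) γ + (1 / γ) ^ 2) ∧
          ∀ u : V, Highway.Informed (Highway.algorithmB M) s γ pos src m
            (Highway.dStarRounds s γ + T) u := by
  -- From `3g ≤ μν ≤ 8g` come `9 = 3²` and `72 = 8 + 8²`; Procedure `T` alone needs only `1 + 6 * 4
  -- = 25`.
  refine ⟨9, 72, by norm_num, by norm_num, ?_⟩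
  intro s γ hs hs1 hγ hγ1 V _ pos hsep hconn M src m
  have hg : 1 ≤ 1 / γ := (one_le_div hγ).2 hγ1
  have hL := Highway.numLabels_le hs hγ hγ1
  have hL' := Highway.le_numLabels (s := s) hγ
  have hlow : 9 * (1 / γ) ^ 2 ≤ (Highway.dStarRounds s γ : ℝ) := by
    have h2 := pow_le_pow_left₀ (by positivity) hL' 2
    have h3 : (0 : ℝ) ≤ Highway.numLabels s γ := Nat.cast_nonneg _
    rw [Highway.dStarRounds]
    push_cast
    linarith [mul_pow 3 (1 / γ) 2]
  have hup : (Highway.dStarRounds s γ : ℝ) ≤ 72 * (1 / γ) ^ 2 := by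
    have h2 := pow_le_pow_left₀ (Nat.cast_nonneg _) hL 2
    have h3 : 1 / γ ≤ (1 / γ) ^ 2 := le_self_pow₀ hg two_ne_zero
    rw [Highway.dStarRounds]
    push_cast
    linarith [mul_pow 8 (1 / γ) 2]
  refine ⟨hlow, hup, Highway.knownLabels_eq hs hs1 hγ hγ1 hsep hconn le_rfl, ?_⟩
  suffices h : ∃ T : ℕ, (T : ℝ) ≤ 72 * ((Highway.swampGraph s pos).diam / max (1 - s) γ) ∧
      ∀ u : V, Highway.Informed (Highway.algorithmB M) s γ pos src m
        (Highway.dStarRounds s γ + T) u by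
    obtain ⟨T, hT, hinf⟩ := h
    refine ⟨T, hT, ?_, hinf⟩
    push_cast
    linarith
  -- For diameter 0 the bound on `T` is 0, which leaves no room for the opening round; the source is
  -- then the only node.
  rcases Nat.eq_zero_or_pos (Highway.swampGraph s pos).diam with hD | hD
  · refine ⟨0, by simp [hD], fun u => Or.inl ?_⟩
    have := hconn.nonempty
    have hle := SimpleGraph.dist_le_diam (SimpleGraph.connected_iff_ediam_ne_top.1 hconn)
      (u := u) (v := src)
    exact hconn.dist_eq_zero_iff.1 (by omega)
  · refine ⟨1 + 6 * Highway.numBlocks s γ * (Highway.swampGraph s pos).diam, ?_, fun u => ?_⟩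
    · have hl := Highway.blockLen_pos (s := s) hγ
      have hl1 := Highway.blockLen_le_one hs hγ1
      have hμ := Highway.numBlocks_le hs hγ hγ1
      have hD1 : (1 : ℝ) ≤ (Highway.swampGraph s pos).diam := by exact_mod_cast hD
      change _ ≤ 72 * (_ / Highway.blockLen s γ)
      generalize ((Highway.swampGraph s pos).diam) = d at *
      have h1 : 1 ≤ (d : ℝ) / Highway.blockLen s γ := (one_le_div hl).2 (hl1.trans hD1)
      have h2 : (Highway.numBlocks s γ : ℝ) * d ≤ 4 / Highway.blockLen s γ * d := by gcongr
      have h3 : 4 / Highway.blockLen s γ * d = 4 * (d / Highway.blockLen s γ) := by ring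
      push_cast
      linarith
    · rw [← add_assoc]
      exact Highway.informed_of_diam hs hs1 hγ hγ1 hsep hconn u
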